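/- Let $Q$ be a smooth $n$-dimensional manifold (Hausdorff and second countable). On $M=\mathbb R\times TQ\times\mathbb R$ use coordinates $(t,q^i,v^i,z)$ induced by charts of $Q$, and let $\mathcal S=\frac{\partial}{\partial v^i}\otimes dq^i$ be the vertical endomorphism and $\Delta=v^i\frac{\partial}{\partial v^i}$ the Liouville vector field. Let $L\in C^\infty(M)$ be a regular Lagrangian, i.e. its fibre Hessian $\bigl(\frac{\partial^2L}{\partial v^i\partial v^j}\bigr)$ is nondegenerate at every point, and put $$E_L=\Delta(L)-L,\qquad \eta_L=dz-dL\circ\mathcal S=dz-\frac{\partial L}{\partial v^i}\,dq^i .$$ (1) Let $\varphi_Q\colon Q\to Q$ and $\varphi_z\colon\mathbb R\to\mathbb R$ be diffeomorphisms, and let $\Phi=(\mathrm{id}_{\mathbb R},T\varphi_Q,\varphi_z)\colon M\to M$ be the action-dependent lift of $(\varphi_Q,\varphi_z)$. Suppose that $\Phi$ is an extended natural symmetry of $L$, that is, $\Phi^*L=\varphi_z'\,L$, where $\varphi_z'=\varphi_z'(z)$ is viewed as a function on $M$. Then $\Phi$ is a $\varphi_z'$-conformal Hamiltonian symmetry of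 $(M,dt,\eta_L,E_L)$: $\Phi$ is a diffeomorphism, $\varphi_z'$ is smooth and vanishes nowhere, and $$\Phi^*t=t,\qquad \Phi^*\eta_L=\varphi_z'\,\eta_L,\qquad \Phi^*E_L=\varphi_z'\,E_L .$$ (2) Let $Y$ be a smooth split vector field on $Q\times\mathbb R$, i.e. one that projects to a vector field $X=X^i(q)\frac{\partial}{\partial q^i}$ on $Q$ and to a vector field $\zeta(z)\frac{\partial}{\partial z}$ on $\mathbb R$, and let $$\bar Y^C=X^i\frac{\partial}{\partial q^i}+v^j\frac{\partial X^i}{\partial q^j}\frac{\partial}{\partial v^i}+\zeta(z)\frac{\partial}{\partial z}$$ be its action-dependent complete lift to $M$. Suppose that $\bar Y^C$ is an infinitesimal extended natural symmetry of $L$, that is, $\mathscr L_{\bar Y^C}L=\zeta'\,L$, where $\zeta'=\zeta'(z)$ is viewed as a function on $M$. Then $\bar Y^C$ is an infinitesimal $\zeta'$-conformal Hamiltonian symmetry of $(M,dt,\eta_L,E_L)$: $\bar Y^C$ and $\zeta'$ are smooth, and $$\iota_{\bar Y^C}\,dt=0,\qquad \mathscr L_{\bar Y^C}\eta_L=\zeta'\,\eta_L,\qquad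 \mathscr L_{\bar Y^C}E_L=\zeta'\,E_L .$$ -/

import Mathlib

open scoped Manifold ContDiff
open Bundle

noncomputable section

namespace CocontactLagrangian

section General

variable {E : Type*} [NormedAddCommGroup E] [NormedSpace ℝ E] {H : Type*} [TopologicalSpace H]
  (I : ModelWithCorners ℝ E H) {M : Type*} [TopologicalSpace M] [ChartedSpace H M]

/-- Not necessarily smooth vector fields on `M`. -/
abbrev VField (M : Type*) [TopologicalSpace M] [ChartedSpace H M] : Type _ :=
  ∀ p : M, TangentSpace I p

/-- Not necessarily smooth differential one-forms on `M`. -/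
abbrev OneForm (M : Type*) [TopologicalSpace M] [ChartedSpace H M] : Type _ :=
  ∀ p : M, TangentSpace I p →L[ℝ] ℝ

variable [IsManifold I 1 M]

/-- The vector field `X` is smooth at `p`, as a section of the tangent bundle. -/
def SmoothFieldAt (X : VField I M) (p : M) : Prop :=
  ContMDiffAt I I.tangent ∞ (fun x => (⟨x, X x⟩ : TangentBundle I M)) p

/-- The vector field `X` is smooth, as a section of the tangent bundle. -/
def SmoothField (X : VField I M) : Prop :=
  ContMDiff I I.tangent ∞ (fun x => (⟨x, X x⟩ : TangentBundle I M))

/-- The differential `dg` of a function `g`, as a one-form. -/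
def differential (g : M → ℝ) : OneForm I M := fun p => mfderiv I 𝓘(ℝ, ℝ) g p

/-- The Lie derivative `ℒ_Y g = dg(Y)` of a function. -/
def lieDerivFun (Y : VField I M) (g : M → ℝ) (p : M) : ℝ := differential I g p (Y p)

/-- The value at `p` of `(ℒ_Y η)(X) = Y(η(X)) - η([Y, X])`. -/
def lieDerivForm (Y : VField I M) (η : OneForm I M) (X : VField I M) (p : M) : ℝ :=
  lieDerivFun I Y (fun x => η x (X x)) p - η p (VectorField.mlieBracket I Y X p)

/-- The pullback `Φ^* η` of a one-form. -/
def pullbackForm (Φ : M → M) (η : OneForm I M) : OneForm I M :=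
  fun p => (η (Φ p)).comp (mfderiv I I Φ p)

/-- `Y` is an infinitesimal `ρ`-conformal Hamiltonian symmetry of `(M, τ, η, h)`:
`ι_Y τ = 0`, `ℒ_Y η = ρ η` and `ℒ_Y h = ρ h`. The equality of one-forms `ℒ_Y η = ρ η` is tested at
each point `p` on all vector fields that are smooth at `p`. -/
structure IsInfinitesimalConformalHamiltonianSymmetry
    (τ η : OneForm I M) (h : M → ℝ) (ρ : M → ℝ) (Y : VField I M) : Prop where
  smooth_field : SmoothField I Y
  smooth_factor : ContMDiff I 𝓘(ℝ, ℝ) ∞ ρ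
  tau_eq_zero : ∀ p, τ p (Y p) = 0
  lie_form : ∀ p, ∀ X : VField I M, SmoothFieldAt I X p →
    lieDerivForm I Y η X p = ρ p * η p (X p)
  lie_fun : ∀ p, lieDerivFun I Y h p = ρ p * h p

variable {N : Type*} [TopologicalSpace N] [ChartedSpace H N]

/-- `Φ` is an `f`-conformal Hamiltonian symmetry of `(ℝ × N, dt, η, h)`: a diffeomorphism with
`Φ^* t = t`, `Φ^* η = f η` and `Φ^* h = f h`, where `f` is smooth and vanishes nowhere. -/
structure IsConformalHamiltonianSymmetry
    (η : OneForm (𝓘(ℝ, ℝ).prod I) (ℝ × N)) (h f : ℝ × N → ℝ) (Φ : ℝ × N → ℝ × N) : Prop where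
  diffeo : ∃ Ψ : Diffeomorph (𝓘(ℝ, ℝ).prod I) (𝓘(ℝ, ℝ).prod I) (ℝ × N) (ℝ × N) ∞, ⇑Ψ = Φ
  smooth_factor : ContMDiff (𝓘(ℝ, ℝ).prod I) 𝓘(ℝ, ℝ) ∞ f
  factor_ne_zero : ∀ p, f p ≠ 0
  pullback_time : ∀ p, (Φ p).1 = p.1
  pullback_form : ∀ p, pullbackForm (𝓘(ℝ, ℝ).prod I) Φ η p = f p • η p
  pullback_fun : ∀ p, h (Φ p) = f p * h p

end General

variable {n : ℕ} {Q : Type*} [TopologicalSpace Q] [ChartedSpace (EuclideanSpace ℝ (Fin n)) Q]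
  [IsManifold (𝓡 n) ∞ Q]

/-- The manifold `TQ × ℝ`. -/
abbrev PhaseFibre (n : ℕ) (Q : Type*) [TopologicalSpace Q]
    [ChartedSpace (EuclideanSpace ℝ (Fin n)) Q] [IsManifold (𝓡 n) ∞ Q] : Type _ := TangentBundle (𝓡 n) Q × ℝ

/-- The phase space `ℝ × TQ × ℝ`, with points `(t, v_q, z)`. -/
abbrev Phase (n : ℕ) (Q : Type*) [TopologicalSpace Q]
    [ChartedSpace (EuclideanSpace ℝ (Fin n)) Q] [IsManifold (𝓡 n) ∞ Q] : Type _ := ℝ × PhaseFibre n Q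

/-- The model with corners of `TQ × ℝ`. -/
abbrev fibreModel (n : ℕ) := (𝓡 n).tangent.prod 𝓘(ℝ, ℝ)

/-- The model with corners of `ℝ × TQ × ℝ`. -/
abbrev phaseModel (n : ℕ) := 𝓘(ℝ, ℝ).prod (fibreModel n)

/-- The coordinate `t` on `ℝ × TQ × ℝ`. -/
def timeCoord (p : Phase n Q) : ℝ := p.1

/-- The coordinate `z` on `ℝ × TQ × ℝ`. -/
def actionCoord (p : Phase n Q) : ℝ := p.2.2

/-- The projection `ℝ × TQ × ℝ → Q`. -/
def baseProj (p : Phase n Q) : Q := p.2.1.proj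

/-- For `p = (t, v_q, z)`, the inclusion `u ↦ (t, u_q, z)` of the fibre `T_q Q`; as a vector space,
`T_q Q` is the model space `EuclideanSpace ℝ (Fin n)`. -/
def fibreIncl (p : Phase n Q) (u : EuclideanSpace ℝ (Fin n)) : Phase n Q :=
  (p.1, (⟨p.2.1.proj, u⟩ : TangentBundle (𝓡 n) Q), p.2.2)

/-- The vertical lift of `u ∈ T_q Q` at the point `p = (t, v_q, z)`, that is, the velocity at
`s = 0` of `s ↦ (t, v_q + s u, z)`, as a linear map in `u`. -/
def verticalLift (p : Phase n Q) :
    TangentSpace (𝓡 n) (baseProj p) →L[ℝ] TangentSpace (phaseModel n) p :=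
  mfderiv 𝓘(ℝ, EuclideanSpace ℝ (Fin n)) (phaseModel n) (fibreIncl p) p.2.1.snd

/-- The vertical endomorphism `𝒮 = ∂/∂vⁱ ⊗ dqⁱ`: project to `TQ`, then lift vertically. -/
def verticalEndomorphism (p : Phase n Q) :
    TangentSpace (phaseModel n) p →L[ℝ] TangentSpace (phaseModel n) p :=
  (verticalLift p).comp (mfderiv (phaseModel n) (𝓡 n) (baseProj : Phase n Q → Q) p)

/-- The Liouville vector field `Δ = vⁱ ∂/∂vⁱ`. -/
def liouville : VField (phaseModel n) (Phase n Q) := fun p => verticalLift p p.2.1.snd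

/-- The Lagrangian energy `E_L = Δ(L) - L`. -/
def energy (L : Phase n Q → ℝ) (p : Phase n Q) : ℝ :=
  lieDerivFun (phaseModel n) liouville L p - L p

/-- The contact Lagrangian form `η_L = dz - θ_L`, with `θ_L = dL ∘ 𝒮`. -/
def contactForm (L : Phase n Q → ℝ) : OneForm (phaseModel n) (Phase n Q) := fun p =>
  differential (phaseModel n) actionCoord p -
    (differential (phaseModel n) L p).comp (verticalEndomorphism p)

/-- `L` is regular: its fibre Hessian is nondegenerate at every point. -/
def IsRegularLagrangian (L : Phase n Q → ℝ) : Prop :=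
  ∀ p : Phase n Q, ∀ u : EuclideanSpace ℝ (Fin n),
    (∀ w : EuclideanSpace ℝ (Fin n),
      fderiv ℝ (fderiv ℝ (fun x => L (fibreIncl p x))) p.2.1.snd u w = 0) → u = 0

/-- The complete lift `X^C = Xⁱ ∂/∂qⁱ + vʲ ∂Xⁱ/∂qʲ ∂/∂vⁱ` to `TQ` of a vector field `X` on `Q`,
written at the point `v` in the coordinates `(q, v)` that the chart of `Q` around the
base point of `v` induces on `TQ`. -/
def completeLift (X : VField (𝓡 n) Q) : VField (𝓡 n).tangent (TangentBundle (𝓡 n) Q) := fun v =>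
  -- `e` is the chart `q` of `Q`, `c` the induced chart `(q, v)` of `TQ`
  let e := extChartAt (𝓡 n) v.proj
  let c := extChartAt (𝓡 n).tangent v
  -- the components `Xⁱ` as functions of the coordinates
  let a : EuclideanSpace ℝ (Fin n) → EuclideanSpace ℝ (Fin n) := fun x =>
    (c (⟨e.symm x, X (e.symm x)⟩ : TangentBundle (𝓡 n) Q)).2
  mfderiv 𝓘(ℝ, EuclideanSpace ℝ (Fin n) × EuclideanSpace ℝ (Fin n)) (𝓡 n).tangent
    c.symm (c v) (a (c v).1, fderiv ℝ a (c v).1 (c v).2)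

/-- The vector field `Y` on `Q × ℝ` is split: it projects to the vector field `X` on `Q` and to the
vector field `ζ ∂/∂z` on `ℝ`. -/
def IsSplit (Y : VField ((𝓡 n).prod 𝓘(ℝ, ℝ)) (Q × ℝ)) (X : VField (𝓡 n) Q) (ζ : ℝ → ℝ) : Prop :=
  ∀ p : Q × ℝ,
    mfderiv ((𝓡 n).prod 𝓘(ℝ, ℝ)) (𝓡 n) (Prod.fst : Q × ℝ → Q) p (Y p) = X p.1 ∧
    mfderiv ((𝓡 n).prod 𝓘(ℝ, ℝ)) 𝓘(ℝ, ℝ) (Prod.snd : Q × ℝ → ℝ) p (Y p) = ζ p.2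

/-- The action-dependent complete lift to `ℝ × TQ × ℝ` of the split vector field `X + ζ ∂/∂z`:
the vector field `0 + X^C + ζ ∂/∂z`. -/
def actionDependentCompleteLift (X : VField (𝓡 n) Q) (ζ : ℝ → ℝ) :
    VField (phaseModel n) (Phase n Q) := fun p =>
  ((0 : ℝ), completeLift X p.2.1, ζ p.2.2)

/-- The action-dependent lift `(id, Tφ_Q, φ_z)` to `ℝ × TQ × ℝ` of `(φ_Q, φ_z)`. -/
def actionDependentLift (φQ : Q → Q) (φz : ℝ → ℝ) (p : Phase n Q) : Phase n Q :=
  (p.1, tangentMap (𝓡 n) (𝓡 n) φQ p.2.1, φz p.2.2)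

/-- `Φ` is an extended natural symmetry of the Lagrangian `L`, with action component `φz`: it is the
action-dependent lift of a diffeomorphism `(φ_Q, φ_z)` of `Q × ℝ`, and `Φ^* L = φ_z' L`. -/
def IsExtendedNaturalSymmetry (L : Phase n Q → ℝ) (φz : Diffeomorph 𝓘(ℝ, ℝ) 𝓘(ℝ, ℝ) ℝ ℝ ∞)
    (Φ : Phase n Q → Phase n Q) : Prop :=
  (∃ φQ : Diffeomorph (𝓡 n) (𝓡 n) Q Q ∞, Φ = actionDependentLift φQ φz) ∧
  ∀ p, L (Φ p) = deriv φz (actionCoord p) * L p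

/-- `Z` is an infinitesimal extended natural symmetry of the Lagrangian `L`, with action component
`ζ`: it is the action-dependent complete lift of a (smooth) split vector field on `Q × ℝ`, and
`ℒ_Z L = ζ' L`. -/
def IsInfinitesimalExtendedNaturalSymmetry (L : Phase n Q → ℝ) (ζ : ℝ → ℝ)
    (Z : VField (phaseModel n) (Phase n Q)) : Prop :=
  (∃ (Y : VField ((𝓡 n).prod 𝓘(ℝ, ℝ)) (Q × ℝ)) (X : VField (𝓡 n) Q),
    SmoothField ((𝓡 n).prod 𝓘(ℝ, ℝ)) Y ∧ IsSplit Y X ζ ∧ Z = actionDependentCompleteLift X ζ) ∧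
  ∀ p, lieDerivFun (phaseModel n) Z L p = deriv ζ (actionCoord p) * L p

end CocontactLagrangian

end

open CocontactLagrangian

/-!
Both parts rest on one observation: the conformal factor is a function of `z` alone, and vertical
vectors, that is, those tangent to the fibres of `TQ`, are annihilated by `dz`. The form
`η_L = dz - dL ∘ 𝒮` and the energy `E_L = Δ(L) - L` involve `dL` only on vertical vectors, so the
invariance `Φ^* L = φ_z' L` can be differentiated there as if the factor were constant
(`differential_mfderiv_verticalLift_of_pullback_eq`).

For a lift `Φ = (id, Tφ_Q, φ_z)` it remains to see that `TΦ` preserves `𝒮` and `Δ`. Indeed `Φ` maps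
the fibre over `q` to the fibre over `φ_Q(q)` by the linear map `T_q φ_Q`, so `TΦ` commutes with
vertical lifts (`mfderiv_actionDependentLift_verticalLift`), and `Φ` covers `φ_Q`
(`verticalEndomorphism_mfderiv_actionDependentLift`).

The infinitesimal statement is proved in coordinates, without flows. With
`Z = aⁱ ∂/∂qⁱ + vʲ ∂aⁱ/∂qʲ ∂/∂vⁱ + ζ ∂/∂z`, differentiating `Z(L) = ζ' L` in the direction `∂/∂vⁱ`
and using the symmetry of `D²L` gives `Z(∂L/∂vⁱ) + ∂aʲ/∂qⁱ ∂L/∂vʲ = ζ' ∂L/∂vⁱ`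
(`fderiv_fderiv_coordLift_verticalVector`), from which both `ℒ_Z η = ζ' η` and `ℒ_Z E = ζ' E`
follow by linear algebra (`lieDeriv_coordContactForm`, `lieDeriv_coordEnergy`).

The Lie bracket at `p` is computed from vector fields near `p` in the preferred chart at `p`, while
the complete lift is given at each point in the chart belonging to that point. The
transition is `mfderiv_extChartAt_completeLift`: the expression of the complete lift is the same in
every induced chart, by the symmetry of the second derivative of the coordinate changes of `Q`.
It also yields the smoothness of the complete lift.
-/

namespace CocontactLagrangian

/-! ### Diffeomorphisms: the lift commutes with the vertical endomorphism -/

section ActionDependentLift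

variable {n : ℕ} {Q : Type*} [TopologicalSpace Q] [ChartedSpace (EuclideanSpace ℝ (Fin n)) Q]
  [IsManifold (𝓡 n) ∞ Q]

lemma contMDiff_baseProj : ContMDiff (phaseModel n) (𝓡 n) ∞ (baseProj : Phase n Q → Q) :=
  (contMDiff_proj (TangentSpace (𝓡 n))).comp (contMDiff_fst.comp contMDiff_snd)

lemma contMDiff_actionCoord :
    ContMDiff (phaseModel n) 𝓘(ℝ, ℝ) ∞ (actionCoord : Phase n Q → ℝ) :=
  contMDiff_snd.comp contMDiff_snd

lemma contMDiff_fibreIncl (p : Phase n Q) :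
    ContMDiff 𝓘(ℝ, EuclideanSpace ℝ (Fin n)) (phaseModel n) ∞ (fibreIncl p) := by
  have h : ContMDiff 𝓘(ℝ, EuclideanSpace ℝ (Fin n)) (𝓡 n).tangent ∞
      (fun u : EuclideanSpace ℝ (Fin n) => (⟨p.2.1.proj, u⟩ : TangentBundle (𝓡 n) Q)) := by
    intro u
    rw [contMDiffAt_totalSpace]
    refine ⟨contMDiffAt_const, ?_⟩
    have := (tangentCoordChange (𝓡 n) p.2.1.proj p.2.1.proj p.2.1.proj).contDiff.contMDiff (n := ∞)
    exact this.contMDiffAt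
  exact contMDiff_const.prodMk (h.prodMk contMDiff_const)

lemma contMDiff_actionDependentLift {φQ : Q → Q} {φz : ℝ → ℝ} (hQ : ContMDiff (𝓡 n) (𝓡 n) ∞ φQ)
    (hz : ContMDiff 𝓘(ℝ, ℝ) 𝓘(ℝ, ℝ) ∞ φz) :
    ContMDiff (phaseModel n) (phaseModel n) ∞ (actionDependentLift φQ φz : Phase n Q → Phase n Q) :=
  contMDiff_fst.prodMk
    (((hQ.contMDiff_tangentMap (by simp)).comp (contMDiff_fst.comp contMDiff_snd)).prodMk
      (hz.comp (contMDiff_snd.comp contMDiff_snd)))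

/-- Product rule for the differential of real functions. -/
lemma differential_mul_apply {E : Type*} [NormedAddCommGroup E] [NormedSpace ℝ E] {H : Type*}
    [TopologicalSpace H] {I : ModelWithCorners ℝ E H} {M : Type*} [TopologicalSpace M]
    [ChartedSpace H M] {f g : M → ℝ} {p : M} (hf : MDifferentiableAt I 𝓘(ℝ, ℝ) f p)
    (hg : MDifferentiableAt I 𝓘(ℝ, ℝ) g p) (w : TangentSpace I p) :
    differential I (fun x => f x * g x) p w =
      f p * differential I g p w + g p * differential I f p w :=
  -- the ascription `E →L[ℝ] ℝ` identifies all tangent spaces with the model space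
  congrArg (fun A : E →L[ℝ] ℝ => A w) (hf.hasMFDerivAt.mul hg.hasMFDerivAt).mfderiv

/-- Chain rule for a function of the action coordinate. -/
lemma differential_comp_actionCoord_apply {f : ℝ → ℝ} {p : Phase n Q}
    (hf : DifferentiableAt ℝ f p.2.2) (w : TangentSpace (phaseModel n) p) :
    differential (phaseModel n) (fun x : Phase n Q => f (actionCoord x)) p w =
      deriv f p.2.2 * differential (phaseModel n) actionCoord p w := by
  have h := mfderiv_comp_apply p (I := phaseModel n) (I' := 𝓘(ℝ, ℝ)) (I'' := 𝓘(ℝ, ℝ)) (g := f)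
    (f := (actionCoord : Phase n Q → ℝ)) hf.mdifferentiableAt
    ((contMDiff_actionCoord (Q := Q) p).mdifferentiableAt (by simp)) w
  refine h.trans ?_
  rw [mfderiv_eq_fderiv]
  have := (fderiv ℝ f p.2.2).map_smul (differential (phaseModel n) actionCoord p w) 1
  rw [fderiv_apply_one_eq_deriv, smul_eq_mul, smul_eq_mul, mul_one, mul_comm] at this
  exact this

/-- Along vertical vectors, the differential of a map on phase space is the derivative of its
restriction to the fibre. -/
lemma mfderiv_verticalLift {E' : Type*} [NormedAddCommGroup E'] [NormedSpace ℝ E'] {H' : Type*}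
    [TopologicalSpace H'] {I' : ModelWithCorners ℝ E' H'} {M' : Type*} [TopologicalSpace M']
    [ChartedSpace H' M'] {g : Phase n Q → M'} {p : Phase n Q}
    (hg : MDifferentiableAt (phaseModel n) I' g p) (u : EuclideanSpace ℝ (Fin n)) :
    mfderiv (phaseModel n) I' g p (verticalLift p u) =
      mfderiv 𝓘(ℝ, EuclideanSpace ℝ (Fin n)) I' (fun u => g (fibreIncl p u)) p.2.1.snd u :=
  (mfderiv_comp_apply p.2.1.snd (g := g) (f := fibreIncl p) hg
    ((contMDiff_fibreIncl p _).mdifferentiableAt (by simp)) u).symm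

/-- Vertical vectors are annihilated by `dz`. -/
lemma differential_actionCoord_verticalLift (p : Phase n Q) (u : EuclideanSpace ℝ (Fin n)) :
    differential (phaseModel n) (actionCoord : Phase n Q → ℝ) p (verticalLift p u) = 0 := by
  refine (mfderiv_verticalLift
    ((contMDiff_actionCoord (Q := Q) p).mdifferentiableAt (by simp)) u).trans ?_
  exact congrArg (fun A : EuclideanSpace ℝ (Fin n) →L[ℝ] ℝ => A u)
    (mfderiv_const (I := 𝓘(ℝ, EuclideanSpace ℝ (Fin n))) (c := p.2.2))

/-- The lift `(id, Tφ_Q, φ_z)` maps fibres to fibres linearly, so it commutes with vertical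
lifts. -/
lemma mfderiv_actionDependentLift_verticalLift {φQ : Q → Q} {φz : ℝ → ℝ}
    (hQ : ContMDiff (𝓡 n) (𝓡 n) ∞ φQ) (hz : ContMDiff 𝓘(ℝ, ℝ) 𝓘(ℝ, ℝ) ∞ φz) (p : Phase n Q)
    (u : TangentSpace (𝓡 n) (baseProj p)) :
    mfderiv (phaseModel n) (phaseModel n) (actionDependentLift φQ φz) p (verticalLift p u) =
      verticalLift (actionDependentLift φQ φz p) (mfderiv (𝓡 n) (𝓡 n) φQ (baseProj p) u) := by
  refine (mfderiv_verticalLift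
    ((contMDiff_actionDependentLift hQ hz p).mdifferentiableAt (by simp)) u).trans ?_
  let A : EuclideanSpace ℝ (Fin n) →L[ℝ] EuclideanSpace ℝ (Fin n) :=
    mfderiv (𝓡 n) (𝓡 n) φQ (baseProj p)
  have h := mfderiv_comp_apply p.2.1.snd (I := 𝓘(ℝ, EuclideanSpace ℝ (Fin n)))
    (I' := 𝓘(ℝ, EuclideanSpace ℝ (Fin n))) (I'' := phaseModel n)
    (g := fibreIncl (actionDependentLift φQ φz p)) (f := A)
    ((contMDiff_fibreIncl _ _).mdifferentiableAt (by simp))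
    A.differentiableAt.mdifferentiableAt u
  refine h.trans (congrArg (verticalLift (actionDependentLift φQ φz p)) ?_)
  exact congrArg (fun B : EuclideanSpace ℝ (Fin n) →L[ℝ] EuclideanSpace ℝ (Fin n) => B u)
    (mfderiv_eq_fderiv.trans A.fderiv)

/-- The lift `(id, Tφ_Q, φ_z)` commutes with the vertical endomorphism. -/
lemma verticalEndomorphism_mfderiv_actionDependentLift {φQ : Q → Q} {φz : ℝ → ℝ}
    (hQ : ContMDiff (𝓡 n) (𝓡 n) ∞ φQ) (hz : ContMDiff 𝓘(ℝ, ℝ) 𝓘(ℝ, ℝ) ∞ φz) (p : Phase n Q)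
    (w : TangentSpace (phaseModel n) p) :
    verticalEndomorphism (actionDependentLift φQ φz p)
        (mfderiv (phaseModel n) (phaseModel n) (actionDependentLift φQ φz) p w) =
      mfderiv (phaseModel n) (phaseModel n) (actionDependentLift φQ φz) p
        (verticalEndomorphism p w) := by
  refine Eq.trans ?_ (mfderiv_actionDependentLift_verticalLift hQ hz p _).symm
  refine congrArg (verticalLift (actionDependentLift φQ φz p)) ?_
  have hΦ := ((contMDiff_actionDependentLift (Q := Q) hQ hz p).mdifferentiableAt (by simp))
  have hπ (p : Phase n Q) := (contMDiff_baseProj (Q := Q) p).mdifferentiableAt (by simp)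
  exact (mfderiv_comp_apply p (hπ _) hΦ w).symm.trans
    (mfderiv_comp_apply p ((hQ _).mdifferentiableAt (by simp)) (hπ p) w)

/-- If `Φ^* L = f(z) L`, then `Φ^*(dL) = f dL` on vertical vectors: the remaining term `L f' dz`
vanishes on them. -/
lemma differential_mfderiv_verticalLift_of_pullback_eq {L : Phase n Q → ℝ}
    (hL : ContMDiff (phaseModel n) 𝓘(ℝ, ℝ) ∞ L) {f : ℝ → ℝ} (hf : Differentiable ℝ f)
    {Φ : Phase n Q → Phase n Q} (hΦ : ContMDiff (phaseModel n) (phaseModel n) ∞ Φ)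
    (h : ∀ p, L (Φ p) = f (actionCoord p) * L p) (p : Phase n Q)
    (u : EuclideanSpace ℝ (Fin n)) :
    differential (phaseModel n) L (Φ p) (mfderiv (phaseModel n) (phaseModel n) Φ p
      (verticalLift p u)) = f p.2.2 * differential (phaseModel n) L p (verticalLift p u) := by
  have hL' (p : Phase n Q) := (hL p).mdifferentiableAt (by simp)
  refine (mfderiv_comp_apply p (hL' _) ((hΦ p).mdifferentiableAt (by simp)) _).symm.trans ?_
  have : L ∘ Φ = fun p => f (actionCoord p) * L p := funext h
  rw [this]
  have hfz : MDifferentiableAt (phaseModel n) 𝓘(ℝ, ℝ) (fun x : Phase n Q => f (actionCoord x)) p :=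
    hf.differentiableAt.mdifferentiableAt.comp p
      ((contMDiff_actionCoord (Q := Q) p).mdifferentiableAt (by simp))
  refine (differential_mul_apply hfz (hL' p) _).trans ?_
  rw [differential_comp_actionCoord_apply hf.differentiableAt,
    differential_actionCoord_verticalLift, mul_zero, mul_zero, add_zero]
  rfl

lemma actionDependentLift_comp {φ ψ : Q → Q} {f g : ℝ → ℝ}
    (hφ : ContMDiff (𝓡 n) (𝓡 n) ∞ φ) (hψ : ContMDiff (𝓡 n) (𝓡 n) ∞ ψ)
    (h : ∀ q, φ (ψ q) = q) (h' : ∀ z, f (g z) = z) (p : Phase n Q) :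
    actionDependentLift φ f (actionDependentLift ψ g p) = p := by
  have h1 := tangentMap_comp_at (I := 𝓡 n) (I' := 𝓡 n) (I'' := 𝓡 n) p.2.1 (g := φ) (f := ψ)
    ((hφ _).mdifferentiableAt (by simp)) ((hψ _).mdifferentiableAt (by simp))
  have h2 : φ ∘ ψ = id := funext h
  rw [h2, tangentMap_id] at h1
  exact Prod.ext rfl (Prod.ext h1.symm (h' _))

/-- Since `Φ` commutes with `𝒮` and preserves `Δ`, the relation `Φ^* L = φ_z' L` passes to `η_L` and
`E_L`. -/
theorem isConformalHamiltonianSymmetry_actionDependentLift {L : Phase n Q → ℝ}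
    (hL : ContMDiff (phaseModel n) 𝓘(ℝ, ℝ) ∞ L) (φQ : Diffeomorph (𝓡 n) (𝓡 n) Q Q ∞)
    (φz : Diffeomorph 𝓘(ℝ, ℝ) 𝓘(ℝ, ℝ) ℝ ℝ ∞)
    (h : ∀ p : Phase n Q, L (actionDependentLift φQ φz p) = deriv φz (actionCoord p) * L p) :
    IsConformalHamiltonianSymmetry (fibreModel n) (contactForm L) (energy L)
      (fun p => deriv φz (actionCoord p)) (actionDependentLift φQ φz) := by
  have hz : ContDiff ℝ ∞ φz := φz.contMDiff.contDiff
  have hz' : ContDiff ℝ ∞ (deriv φz) := (contDiff_infty_iff_deriv.1 hz).2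
  have hdz : Differentiable ℝ φz := hz.differentiable (by simp)
  have hdz' : Differentiable ℝ (deriv φz) := hz'.differentiable (by simp)
  have hΦ := contMDiff_actionDependentLift (Q := Q) φQ.contMDiff φz.contMDiff
  have key := differential_mfderiv_verticalLift_of_pullback_eq hL hdz' hΦ h
  refine ⟨⟨⟨⟨_, actionDependentLift φQ.symm φz.symm, ?_, ?_⟩, hΦ,
    contMDiff_actionDependentLift φQ.symm.contMDiff φz.symm.contMDiff⟩, rfl⟩,
    hz'.contMDiff.comp contMDiff_actionCoord, ?_, fun _ => rfl, ?_, ?_⟩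
  · exact actionDependentLift_comp φQ.symm.contMDiff φQ.contMDiff
      φQ.symm_apply_apply φz.symm_apply_apply
  · exact actionDependentLift_comp φQ.contMDiff φQ.symm.contMDiff
      φQ.apply_symm_apply φz.apply_symm_apply
  · intro p h0
    -- the chain rule for `φ_z⁻¹ ∘ φ_z = id` shows that `φ_z'` does not vanish
    have h1 : HasDerivAt (φz.symm ∘ φz) _ p.2.2 :=
      ((φz.symm.contMDiff.contDiff.differentiable (by simp)) _).hasDerivAt.comp _
        (hdz p.2.2).hasDerivAt
    have h2 : φz.symm ∘ φz = id := funext φz.symm_apply_apply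
    have h3 := h1.unique (h2 ▸ hasDerivAt_id _)
    rw [show deriv φz p.2.2 = 0 from h0, mul_zero] at h3
    exact zero_ne_one h3
  · intro p
    refine ContinuousLinearMap.ext fun w => ?_
    have e1 : differential (phaseModel n) actionCoord (actionDependentLift φQ φz p)
        (mfderiv (phaseModel n) (phaseModel n) (actionDependentLift φQ φz) p w) =
        deriv φz p.2.2 * differential (phaseModel n) actionCoord p w :=
      (mfderiv_comp_apply p ((contMDiff_actionCoord _).mdifferentiableAt (by simp))
        ((hΦ p).mdifferentiableAt (by simp)) w).symm.trans
        (differential_comp_actionCoord_apply hdz.differentiableAt w)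
    -- the term `dL ∘ 𝒮` only sees vertical vectors, on which `dL` is conformally invariant
    have e2 := verticalEndomorphism_mfderiv_actionDependentLift φQ.contMDiff φz.contMDiff p w
    have e3 := key p (mfderiv (phaseModel n) (𝓡 n) (baseProj : Phase n Q → Q) p w)
    refine (congrArg₂ (· - ·) e1
      ((congrArg (differential (phaseModel n) L _) e2).trans e3)).trans ?_
    exact (mul_sub _ _ _).symm
  · intro p
    have e1 := key p p.2.1.snd
    have e2 := mfderiv_actionDependentLift_verticalLift φQ.contMDiff φz.contMDiff p p.2.1.snd
    rw [e2] at e1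
    refine (congrArg₂ (· - ·) e1 (h p)).trans ?_
    exact (mul_sub _ _ _).symm

end ActionDependentLift

/-! ### Infinitesimal symmetries in coordinates -/

section Coordinates

open Filter Topology

variable {F : Type*} [NormedAddCommGroup F] [NormedSpace ℝ F]

/-- The vertical vector `uⁱ ∂/∂vⁱ` in the coordinates `(t, (q, v), z)`. -/
noncomputable def verticalVector (F : Type*) [NormedAddCommGroup F] [NormedSpace ℝ F] :
    F →L[ℝ] ℝ × (F × F) × ℝ :=
  (ContinuousLinearMap.inr ℝ ℝ ((F × F) × ℝ)).comp
    ((ContinuousLinearMap.inl ℝ (F × F) ℝ).comp (ContinuousLinearMap.inr ℝ F F))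

lemma verticalVector_apply (u : F) : verticalVector F u = (0, (0, u), 0) := rfl

/-- The linear coordinate `q` on the space of `(t, (q, v), z)`. -/
noncomputable def basePart (F : Type*) [NormedAddCommGroup F] [NormedSpace ℝ F] :
    ℝ × (F × F) × ℝ →L[ℝ] F :=
  (ContinuousLinearMap.fst ℝ F F).comp
    ((ContinuousLinearMap.fst ℝ (F × F) ℝ).comp (ContinuousLinearMap.snd ℝ ℝ ((F × F) × ℝ)))

/-- The linear coordinate `v` on the space of `(t, (q, v), z)`. -/
noncomputable def velocityPart (F : Type*) [NormedAddCommGroup F] [NormedSpace ℝ F] :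
    ℝ × (F × F) × ℝ →L[ℝ] F :=
  (ContinuousLinearMap.snd ℝ F F).comp
    ((ContinuousLinearMap.fst ℝ (F × F) ℝ).comp (ContinuousLinearMap.snd ℝ ℝ ((F × F) × ℝ)))

/-- The linear coordinate `z` on the space of `(t, (q, v), z)`. -/
noncomputable def actionPart (F : Type*) [NormedAddCommGroup F] [NormedSpace ℝ F] :
    ℝ × (F × F) × ℝ →L[ℝ] ℝ :=
  (ContinuousLinearMap.snd ℝ (F × F) ℝ).comp (ContinuousLinearMap.snd ℝ ℝ ((F × F) × ℝ))

/-- The action-dependent complete lift `aⁱ ∂/∂qⁱ + vʲ ∂aⁱ/∂qʲ ∂/∂vⁱ + ζ ∂/∂z` in coordinates. -/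
noncomputable def coordLift (a : F → F) (ζ : ℝ → ℝ) (x : ℝ × (F × F) × ℝ) : ℝ × (F × F) × ℝ :=
  (0, (a (basePart F x), fderiv ℝ a (basePart F x) (velocityPart F x)), ζ (actionPart F x))

/-- The one-form `dz - ∂Λ/∂vⁱ dqⁱ` in coordinates. -/
noncomputable def coordContactForm (Λ : ℝ × (F × F) × ℝ → ℝ) (x w : ℝ × (F × F) × ℝ) : ℝ :=
  actionPart F w - fderiv ℝ Λ x (verticalVector F (basePart F w))

/-- The energy `vⁱ ∂Λ/∂vⁱ - Λ` in coordinates. -/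
noncomputable def coordEnergy (Λ : ℝ × (F × F) × ℝ → ℝ) (x : ℝ × (F × F) × ℝ) : ℝ :=
  fderiv ℝ Λ x (verticalVector F (velocityPart F x)) - Λ x

variable {Λ : ℝ × (F × F) × ℝ → ℝ} {a : F → F} {ζ : ℝ → ℝ} {x : ℝ × (F × F) × ℝ}

lemma hasFDerivAt_coordLift (ha : ContDiffAt ℝ 2 a (basePart F x)) (hζ : Differentiable ℝ ζ) :
    HasFDerivAt (coordLift a ζ)
      ((0 : ℝ × (F × F) × ℝ →L[ℝ] ℝ).prod
        ((((fderiv ℝ a (basePart F x)).comp (basePart F)).prod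
          ((fderiv ℝ a (basePart F x)).comp (velocityPart F) +
            ((fderiv ℝ (fderiv ℝ a) (basePart F x)).comp (basePart F)).flip
              (velocityPart F x))).prod
          (deriv ζ (actionPart F x) • actionPart F))) x := by
  have h1 : HasFDerivAt (fun x => a (basePart F x)) _ x :=
    (ha.differentiableAt (by simp)).hasFDerivAt.comp x (basePart F).hasFDerivAt
  have h2 : HasFDerivAt (fun x => fderiv ℝ a (basePart F x)) _ x :=
    (((ha.fderiv_right (m := 1) le_rfl).differentiableAt (by simp)).hasFDerivAt).comp x
      (basePart F).hasFDerivAt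
  have h3 := h2.clm_apply (velocityPart F).hasFDerivAt
  have h4 : HasFDerivAt (fun x => ζ (actionPart F x)) _ x :=
    (hζ _).hasDerivAt.comp_hasFDerivAt x (actionPart F).hasFDerivAt
  exact (hasFDerivAt_const 0 x).prodMk ((h1.prodMk h3).prodMk h4)

lemma fderiv_coordLift_apply (ha : ContDiffAt ℝ 2 a (basePart F x)) (hζ : Differentiable ℝ ζ)
    (w : ℝ × (F × F) × ℝ) :
    fderiv ℝ (coordLift a ζ) x w =
      (0, (fderiv ℝ a (basePart F x) (basePart F w),
        fderiv ℝ a (basePart F x) (velocityPart F w) +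
          fderiv ℝ (fderiv ℝ a) (basePart F x) (basePart F w) (velocityPart F x)),
        deriv ζ (actionPart F x) * actionPart F w) := by
  rw [(hasFDerivAt_coordLift ha hζ).fderiv]
  rfl

lemma hasFDerivAt_fderiv (hΛ : ContDiffAt ℝ 2 Λ x) :
    HasFDerivAt (fderiv ℝ Λ) (fderiv ℝ (fderiv ℝ Λ) x) x :=
  ((hΛ.fderiv_right (m := 1) le_rfl).differentiableAt (by simp)).hasFDerivAt

/-- The invariance `ℒ_Z Λ = ζ' Λ`, differentiated in a vertical direction. The factor `ζ'` is
constant in that direction, and `[∂/∂vⁱ, Z] = ∂aʲ/∂qⁱ ∂/∂vʲ`. -/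
lemma fderiv_fderiv_coordLift_verticalVector (hΛ : ContDiffAt ℝ 2 Λ x)
    (ha : ContDiffAt ℝ 2 a (basePart F x)) (hζ : ContDiff ℝ 2 ζ)
    (hinv : ∀ᶠ y in 𝓝 x, fderiv ℝ Λ y (coordLift a ζ y) = deriv ζ (actionPart F y) * Λ y) (u : F) :
    fderiv ℝ (fderiv ℝ Λ) x (coordLift a ζ x) (verticalVector F u) +
        fderiv ℝ Λ x (verticalVector F (fderiv ℝ a (basePart F x) u)) =
      deriv ζ (actionPart F x) * fderiv ℝ Λ x (verticalVector F u) := by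
  have hζ1 : Differentiable ℝ ζ := hζ.differentiable (by simp)
  have hζ2 : Differentiable ℝ (deriv ζ) :=
    (hζ.iterate_deriv' 1 1).differentiable (by simp)
  have h1 := (hasFDerivAt_fderiv hΛ).clm_apply (hasFDerivAt_coordLift ha hζ1)
  have h2 : HasFDerivAt (fun y => deriv ζ (actionPart F y) * Λ y) _ x :=
    ((hζ2 _).hasDerivAt.comp_hasFDerivAt x (actionPart F).hasFDerivAt).mul
      (hΛ.differentiableAt (by simp)).hasFDerivAt
  have h3 := congrArg (fun A => A (verticalVector F u)) ((h1.congr_of_eventuallyEq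
    (hinv.mono fun y hy => hy.symm)).unique h2)
  have hsymm : fderiv ℝ (fderiv ℝ Λ) x (verticalVector F u) (coordLift a ζ x) =
      fderiv ℝ (fderiv ℝ Λ) x (coordLift a ζ x) (verticalVector F u) :=
    (hΛ.isSymmSndFDerivAt (by simp)).eq _ _
  have e1 : basePart F (verticalVector F u) = 0 := rfl
  have e2 : velocityPart F (verticalVector F u) = u := rfl
  have e3 : actionPart F (verticalVector F u) = 0 := rfl
  simp [e1, e2, e3, hsymm] at h3
  rw [verticalVector_apply (fderiv ℝ a _ u)]
  linarith

lemma hasFDerivAt_coordContactForm (hΛ : ContDiffAt ℝ 2 Λ x)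
    {X : ℝ × (F × F) × ℝ → ℝ × (F × F) × ℝ} (hX : DifferentiableAt ℝ X x) :
    HasFDerivAt (fun y => coordContactForm Λ y (X y))
      ((actionPart F).comp (fderiv ℝ X x) -
        ((fderiv ℝ Λ x).comp (((verticalVector F).comp (basePart F)).comp (fderiv ℝ X x)) +
          (fderiv ℝ (fderiv ℝ Λ) x).flip (verticalVector F (basePart F (X x))))) x :=
  ((actionPart F).hasFDerivAt.comp x hX.hasFDerivAt).sub
    ((hasFDerivAt_fderiv hΛ).clm_apply
      ((((verticalVector F).comp (basePart F)).hasFDerivAt).comp x hX.hasFDerivAt))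

lemma hasFDerivAt_coordEnergy (hΛ : ContDiffAt ℝ 2 Λ x) :
    HasFDerivAt (coordEnergy Λ)
      ((fderiv ℝ Λ x).comp ((verticalVector F).comp (velocityPart F)) +
        (fderiv ℝ (fderiv ℝ Λ) x).flip (verticalVector F (velocityPart F x)) - fderiv ℝ Λ x) x :=
  ((hasFDerivAt_fderiv hΛ).clm_apply
    ((verticalVector F).comp (velocityPart F)).hasFDerivAt).sub
      (hΛ.differentiableAt (by simp)).hasFDerivAt

/-- The identity `ℒ_Z η = ζ' η` in coordinates. -/
lemma lieDeriv_coordContactForm (hΛ : ContDiffAt ℝ 2 Λ x)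
    (ha : ContDiffAt ℝ 2 a (basePart F x)) (hζ : ContDiff ℝ 2 ζ)
    (hinv : ∀ᶠ y in 𝓝 x, fderiv ℝ Λ y (coordLift a ζ y) = deriv ζ (actionPart F y) * Λ y)
    {X : ℝ × (F × F) × ℝ → ℝ × (F × F) × ℝ} (hX : DifferentiableAt ℝ X x) :
    fderiv ℝ (fun y => coordContactForm Λ y (X y)) x (coordLift a ζ x) -
        coordContactForm Λ x (VectorField.lieBracket ℝ (coordLift a ζ) X x) =
      deriv ζ (actionPart F x) * coordContactForm Λ x (X x) := by
  have key := fderiv_fderiv_coordLift_verticalVector hΛ ha hζ hinv (basePart F (X x))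
  rw [(hasFDerivAt_coordContactForm hΛ hX).fderiv, VectorField.lieBracket]
  have e1 (w) : basePart F (fderiv ℝ (coordLift a ζ) x w) =
      fderiv ℝ a (basePart F x) (basePart F w) := by
    rw [fderiv_coordLift_apply ha (hζ.differentiable (by simp))]; rfl
  have e2 (w) : actionPart F (fderiv ℝ (coordLift a ζ) x w) =
      deriv ζ (actionPart F x) * actionPart F w := by
    rw [fderiv_coordLift_apply ha (hζ.differentiable (by simp))]; rfl
  simp only [coordContactForm, map_sub, e1, e2]
  simp
  linarith

/-- The identity `ℒ_Z E = ζ' E` in coordinates. -/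
lemma lieDeriv_coordEnergy (hΛ : ContDiffAt ℝ 2 Λ x)
    (ha : ContDiffAt ℝ 2 a (basePart F x)) (hζ : ContDiff ℝ 2 ζ)
    (hinv : ∀ᶠ y in 𝓝 x, fderiv ℝ Λ y (coordLift a ζ y) = deriv ζ (actionPart F y) * Λ y) :
    fderiv ℝ (coordEnergy Λ) x (coordLift a ζ x) =
      deriv ζ (actionPart F x) * coordEnergy Λ x := by
  have key := fderiv_fderiv_coordLift_verticalVector hΛ ha hζ hinv (velocityPart F x)
  rw [(hasFDerivAt_coordEnergy hΛ).fderiv]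
  have e : velocityPart F (coordLift a ζ x) =
    fderiv ℝ a (basePart F x) (velocityPart F x) := rfl
  have h0 := hinv.self_of_nhds
  simp [coordEnergy, e, h0]
  linarith

/-- The coordinate expression of the complete lift is compatible with the change of coordinates
`(q, v) ↦ (ψ(q), Dψ(q) v)`, by the symmetry of the second derivative of `ψ`. -/
lemma fderiv_tangent_coordChange_apply {ψ a b : F → F} {x : F} (hψ : ContDiffAt ℝ 2 ψ x)
    (ha : DifferentiableAt ℝ a x) (hb : DifferentiableAt ℝ b (ψ x))
    (hab : ∀ᶠ y in 𝓝 x, b (ψ y) = fderiv ℝ ψ y (a y)) (v : F) :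
    fderiv ℝ (fun y : F × F => (ψ y.1, fderiv ℝ ψ y.1 y.2)) (x, v) (a x, fderiv ℝ a x v) =
      (b (ψ x), fderiv ℝ b (ψ x) (fderiv ℝ ψ x v)) := by
  have hψ1 := (hψ.differentiableAt (by simp)).hasFDerivAt
  have hψ2 := ((hψ.fderiv_right (m := 1) le_rfl).differentiableAt (by simp)).hasFDerivAt
  have h1 : HasFDerivAt (fun y : F × F => (ψ y.1, fderiv ℝ ψ y.1 y.2)) _ (x, v) :=
    (HasFDerivAt.comp (x, v) (f := Prod.fst) (g := ψ) hψ1 hasFDerivAt_fst).prodMk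
      ((HasFDerivAt.comp (x, v) (f := Prod.fst) (g := fderiv ℝ ψ) hψ2 hasFDerivAt_fst).clm_apply
        hasFDerivAt_snd)
  have h2 : HasFDerivAt (fun y => b (ψ y)) _ x := hb.hasFDerivAt.comp x hψ1
  have h3 := congrArg (fun A => A v) ((h2.congr_of_eventuallyEq
    (hab.mono fun y hy => hy.symm)).unique (hψ2.clm_apply ha.hasFDerivAt))
  have hsymm : fderiv ℝ (fderiv ℝ ψ) x v (a x) = fderiv ℝ (fderiv ℝ ψ) x (a x) v :=
    (hψ.isSymmSndFDerivAt (by simp)).eq _ _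
  simp [hsymm] at h3
  rw [h1.fderiv]
  simp [h3, hab.self_of_nhds]

end Coordinates

/-! ### Differentials, vector fields and brackets in the preferred chart -/

section Charts

open Filter Topology

variable {E : Type*} [NormedAddCommGroup E] [NormedSpace ℝ E] {H : Type*} [TopologicalSpace H]
  {I : ModelWithCorners ℝ E H} {M : Type*} [TopologicalSpace M] [ChartedSpace H M]

variable (I) in
/-- The vector field `V` in the preferred chart at `p`, written as the pullback by which Mathlib
defines the Lie bracket. It is only meaningful on the target of the chart. -/
noncomputable abbrev chartField (V : VField I M) (p : M) (x : E) : E :=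
  VectorField.mpullbackWithin 𝓘(ℝ, E) I (extChartAt I p).symm V (Set.range I) x

section
variable [IsManifold I 1 M]

lemma chartField_eq {V : VField I M} {p : M} {x : E} (hx : x ∈ (extChartAt I p).target) :
    chartField I V p x = mfderiv I 𝓘(ℝ, E) (extChartAt I p) ((extChartAt I p).symm x)
      (V ((extChartAt I p).symm x)) :=
  congrArg (fun A : TangentSpace I ((extChartAt I p).symm x) →L[ℝ] E =>
      A (V ((extChartAt I p).symm x)))
    (ContinuousLinearMap.inverse_eq
      (mfderivWithin_extChartAt_symm_comp_mfderiv_extChartAt hx)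
      (mfderiv_extChartAt_comp_mfderivWithin_extChartAt_symm hx))

/-- Differentiability at `p` may be checked in the preferred chart at `p`. -/
lemma mdifferentiableAt_of_comp_extChartAt_symm {g : M → ℝ} {p : M}
    (hg : DifferentiableAt ℝ (g ∘ (extChartAt I p).symm) (extChartAt I p p)) :
    MDifferentiableAt I 𝓘(ℝ, ℝ) g p := by
  have h := hg.mdifferentiableAt.comp p
    (mdifferentiableAt_extChartAt (I := I) (mem_chart_source H p))
  refine h.congr_of_eventuallyEq ?_
  filter_upwards [extChartAt_source_mem_nhds (I := I) p] with q hq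
  exact congrArg g ((extChartAt I p).left_inv hq).symm

variable [I.Boundaryless]

lemma mdifferentiableAt_extChartAt_symm {p : M} {x : E} (hx : x ∈ (extChartAt I p).target) :
    MDifferentiableAt 𝓘(ℝ, E) I (extChartAt I p).symm x := by
  have := mdifferentiableWithinAt_extChartAt_symm hx
  rwa [I.range_eq_univ, mdifferentiableWithinAt_univ] at this

lemma mfderiv_extChartAt_symm_mfderiv_extChartAt {p : M} {x : E}
    (hx : x ∈ (extChartAt I p).target) (w : TangentSpace I ((extChartAt I p).symm x)) :
    mfderiv 𝓘(ℝ, E) I (extChartAt I p).symm x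
      (mfderiv I 𝓘(ℝ, E) (extChartAt I p) ((extChartAt I p).symm x) w) = w := by
  have := mfderivWithin_extChartAt_symm_comp_mfderiv_extChartAt hx
  rw [I.range_eq_univ, mfderivWithin_univ] at this
  exact congrArg (fun A : TangentSpace I ((extChartAt I p).symm x) →L[ℝ]
    TangentSpace I ((extChartAt I p).symm x) => A w) this

/-- The derivative of a vector-valued function, computed in a chart at any point of its domain. -/
lemma fderiv_comp_extChartAt_symm {G : Type*} [NormedAddCommGroup G] [NormedSpace ℝ G] {g : M → G}
    {p : M} {x : E} (hx : x ∈ (extChartAt I p).target)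
    (hg : MDifferentiableAt I 𝓘(ℝ, G) g ((extChartAt I p).symm x))
    (w : TangentSpace I ((extChartAt I p).symm x)) :
    fderiv ℝ (g ∘ (extChartAt I p).symm) x
        (mfderiv I 𝓘(ℝ, E) (extChartAt I p) ((extChartAt I p).symm x) w) =
      mfderiv I 𝓘(ℝ, G) g ((extChartAt I p).symm x) w := by
  refine (congrArg (fun A : E →L[ℝ] G => A _) mfderiv_eq_fderiv.symm).trans ?_
  refine (mfderiv_comp_apply x hg (mdifferentiableAt_extChartAt_symm hx) _).trans ?_
  exact congrArg _ (mfderiv_extChartAt_symm_mfderiv_extChartAt hx w)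

lemma lieDerivFun_extChartAt_symm {g : M → ℝ} {V : VField I M} {p : M} {x : E}
    (hx : x ∈ (extChartAt I p).target)
    (hg : MDifferentiableAt I 𝓘(ℝ, ℝ) g ((extChartAt I p).symm x)) :
    fderiv ℝ (g ∘ (extChartAt I p).symm) x (chartField I V p x) =
      lieDerivFun I V g ((extChartAt I p).symm x) := by
  rw [chartField_eq hx]
  exact fderiv_comp_extChartAt_symm hx hg _

lemma lieDerivFun_eq_fderiv {g : M → ℝ} {V : VField I M} {p : M}
    (hg : MDifferentiableAt I 𝓘(ℝ, ℝ) g p) :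
    lieDerivFun I V g p =
      fderiv ℝ (g ∘ (extChartAt I p).symm) (extChartAt I p p)
        (chartField I V p (extChartAt I p p)) := by
  have h := lieDerivFun_extChartAt_symm (V := V) (mem_extChartAt_target (I := I) p)
    (by rwa [extChartAt_to_inv])
  rw [h, extChartAt_to_inv]

/-- In the preferred chart at `p`, the Lie bracket at `p` is the bracket of the coordinate
expressions. -/
lemma mlieBracket_eq_lieBracket {V W : VField I M} {p : M} :
    VectorField.mlieBracket I V W p =
      VectorField.lieBracket ℝ (chartField I V p) (chartField I W p) (extChartAt I p p) := by
  have hs : (extChartAt I p).symm ⁻¹' Set.univ ∩ Set.range I = Set.univ := by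
    rw [I.range_eq_univ, Set.preimage_univ, Set.univ_inter]
  have hB (X Y : E → E) : VectorField.lieBracketWithin ℝ X Y
      ((extChartAt I p).symm ⁻¹' Set.univ ∩ Set.range I) (extChartAt I p p) =
      VectorField.lieBracket ℝ X Y (extChartAt I p p) := by
    rw [hs, VectorField.lieBracketWithin_univ]
  have hA : (mfderiv I 𝓘(ℝ, E) (extChartAt I p) p).inverse = ContinuousLinearMap.id ℝ E :=
    (congrArg (fun A : E →L[ℝ] E => A.inverse) mfderiv_extChartAt_self).trans
      ContinuousLinearMap.inverse_id
  exact (congrArg (fun A : E →L[ℝ] E => A _) hA).trans (hB _ _)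

end

variable [CompleteSpace E] [IsManifold I 1 M]

/-- A vector field is smooth at `p` if its expression in the preferred chart at `p` is. -/
lemma smoothFieldAt_of_chartField [IsManifold I ∞ M] {V : VField I M}
    {p : M} {W : E → E} (hW : ContDiffAt ℝ ∞ W (extChartAt I p p))
    (h : ∀ x ∈ (extChartAt I p).target, chartField I V p x = W x) : SmoothFieldAt I V p := by
  have h1 := ContMDiffAt.mpullback_vectorField_preimage (f := extChartAt I p) (n := ∞) (m := ∞)
    (x₀ := p) (I := I) (V := W) (contMDiffAt_vectorSpace_iff_contDiffAt.2 hW)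
    contMDiffAt_extChartAt (isInvertible_mfderiv_extChartAt (mem_extChartAt_source p)) (by simp)
  refine h1.congr_of_eventuallyEq ?_
  filter_upwards [extChartAt_source_mem_nhds (I := I) p] with q hq
  refine congrArg (TotalSpace.mk q) ?_
  have hx := (extChartAt I p).map_source hq
  have hinv := isInvertible_mfderiv_extChartAt (I := I) hq
  have h2 := h _ hx
  rw [chartField_eq hx, (extChartAt I p).left_inv hq] at h2
  obtain ⟨A, hA⟩ := hinv
  have h3 : (mfderiv I 𝓘(ℝ, E) (extChartAt I p) q).inverse = A.symm := by
    rw [← hA, ContinuousLinearMap.inverse_equiv]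
  refine (A.symm_apply_apply (V q)).symm.trans ?_
  refine (congrArg A.symm ((congrArg (fun B => B (V q)) hA).trans h2)).trans ?_
  exact (congrArg (fun B : E →L[ℝ] E => B (W (extChartAt I p q))) h3).symm

variable [I.Boundaryless]

lemma SmoothFieldAt.differentiableAt_chartField [IsManifold I 2 M] {V : VField I M} {p : M}
    (h : SmoothFieldAt I V p) :
    DifferentiableAt ℝ (chartField I V p) (extChartAt I p p) := by
  have h1 : MDifferentiableWithinAt I I.tangent (fun x => (⟨x, V x⟩ : TangentBundle I M))
    Set.univ p := (ContMDiffAt.mdifferentiableAt h (by simp)).mdifferentiableWithinAt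
  have h2 := h1.differentiableWithinAt_mpullbackWithin_vectorField
  have hs : (extChartAt I p).symm ⁻¹' Set.univ ∩ Set.range I = Set.univ := by
    rw [I.range_eq_univ, Set.preimage_univ, Set.univ_inter]
  rw [hs] at h2
  exact differentiableWithinAt_univ.1 h2

end Charts

/-! ### Induced charts of the tangent bundle and the complete lift -/

section PhaseCharts

open Filter Topology

variable {n : ℕ} {Q : Type*} [TopologicalSpace Q] [ChartedSpace (EuclideanSpace ℝ (Fin n)) Q]
  [IsManifold (𝓡 n) ∞ Q]

/-- The chart of `TQ` induced by a chart `q` of `Q` is `(q, v) = (q, dq)`. -/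
lemma extChartAt_tangent_apply {v₀ v : TangentBundle (𝓡 n) Q}
    (hv : v.proj ∈ (extChartAt (𝓡 n) v₀.proj).source) :
    extChartAt (𝓡 n).tangent v₀ v = (extChartAt (𝓡 n) v₀.proj v.proj,
      mfderiv (𝓡 n) 𝓘(ℝ, EuclideanSpace ℝ (Fin n)) (extChartAt (𝓡 n) v₀.proj) v.proj v.snd) := by
  rw [extChartAt_source] at hv
  have h := TangentBundle.continuousLinearMapAt_trivializationAt (I := 𝓡 n) hv
  have h' := TangentBundle.continuousLinearMapAt_trivializationAt_eq_core (I := 𝓡 n) hv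
  refine Prod.ext rfl ?_
  exact congrArg (fun A : EuclideanSpace ℝ (Fin n) →L[ℝ] EuclideanSpace ℝ (Fin n) => A v.snd)
    (h'.symm.trans h)

lemma extChartAt_phase_apply (p₀ p : Phase n Q) :
    extChartAt (phaseModel n) p₀ p = (p.1, extChartAt (𝓡 n).tangent p₀.2.1 p.2.1, p.2.2) := rfl

lemma mem_extChartAt_tangent_source {v₀ v : TangentBundle (𝓡 n) Q} :
    v ∈ (extChartAt (𝓡 n).tangent v₀).source ↔
      v.proj ∈ (extChartAt (𝓡 n) v₀.proj).source := by
  rw [extChartAt_source, extChartAt_source, TangentBundle.mem_chart_source_iff]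

lemma mem_extChartAt_phase_source {p₀ p : Phase n Q} :
    p ∈ (extChartAt (phaseModel n) p₀).source ↔
      baseProj p ∈ (extChartAt (𝓡 n) (baseProj p₀)).source := by
  rw [extChartAt_prod, extChartAt_prod]
  simp [baseProj, chartAt_self_eq]

/-- The components of `X` are smooth on the whole chart domain, not only at its base point `q`. -/
lemma contDiffAt_chartField {X : VField (𝓡 n) Q} (hX : SmoothField (𝓡 n) X) {q : Q}
    {x : EuclideanSpace ℝ (Fin n)} (hx : x ∈ (extChartAt (𝓡 n) q).target) :
    ContDiffAt ℝ ∞ (chartField (𝓡 n) X q) x := by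
  have hq := (extChartAt (𝓡 n) q).map_target hx
  have h1 : ContMDiffAt 𝓘(ℝ, EuclideanSpace ℝ (Fin n)) (𝓡 n) ∞ (extChartAt (𝓡 n) q).symm x :=
    (contMDiffOn_extChartAt_symm q).contMDiffAt (extChartAt_target_mem_nhds' hx)
  have h2 : ContMDiffAt (𝓡 n).tangent 𝓘(ℝ, EuclideanSpace ℝ (Fin n) × EuclideanSpace ℝ (Fin n)) ∞
      (extChartAt (𝓡 n).tangent (⟨q, 0⟩ : TangentBundle (𝓡 n) Q))
      (⟨(extChartAt (𝓡 n) q).symm x, X ((extChartAt (𝓡 n) q).symm x)⟩ : TangentBundle (𝓡 n) Q) :=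
    contMDiffAt_extChartAt' (by
      rw [TangentBundle.mem_chart_source_iff, ← extChartAt_source (𝓡 n)]; exact hq)
  have h3 := (h2.comp x ((hX _).comp x h1)).contDiffAt.snd
  refine h3.congr_of_eventuallyEq ?_
  filter_upwards [extChartAt_target_mem_nhds' hx] with y hy
  rw [chartField_eq hy]
  exact (congrArg Prod.snd (extChartAt_tangent_apply (v₀ := ⟨q, 0⟩)
    (v := ⟨_, X ((extChartAt (𝓡 n) q).symm y)⟩) ((extChartAt (𝓡 n) q).map_target hy))).symm

/-- The local components `Xⁱ` in the definition of the complete lift are those of `chartField`. -/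
lemma completeLift_eq (X : VField (𝓡 n) Q) (v : TangentBundle (𝓡 n) Q) :
    completeLift X v =
      mfderiv 𝓘(ℝ, EuclideanSpace ℝ (Fin n) × EuclideanSpace ℝ (Fin n)) (𝓡 n).tangent
        (extChartAt (𝓡 n).tangent v).symm (extChartAt (𝓡 n).tangent v v)
        (chartField (𝓡 n) X v.proj (extChartAt (𝓡 n) v.proj v.proj),
          fderiv ℝ (chartField (𝓡 n) X v.proj) (extChartAt (𝓡 n) v.proj v.proj)
            (extChartAt (𝓡 n).tangent v v).2) := by
  have h : (fun x => (extChartAt (𝓡 n).tangent v (⟨(extChartAt (𝓡 n) v.proj).symm x,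
      X ((extChartAt (𝓡 n) v.proj).symm x)⟩ : TangentBundle (𝓡 n) Q)).2)
      =ᶠ[𝓝 (extChartAt (𝓡 n) v.proj v.proj)] chartField (𝓡 n) X v.proj := by
    filter_upwards [extChartAt_target_mem_nhds v.proj] with x hx
    rw [chartField_eq hx]
    exact congrArg Prod.snd (extChartAt_tangent_apply (v₀ := v)
      (v := ⟨_, X ((extChartAt (𝓡 n) v.proj).symm x)⟩) ((extChartAt (𝓡 n) v.proj).map_target hx))
  exact congrArg (mfderiv 𝓘(ℝ, EuclideanSpace ℝ (Fin n) × EuclideanSpace ℝ (Fin n)) (𝓡 n).tangent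
        (extChartAt (𝓡 n).tangent v).symm (extChartAt (𝓡 n).tangent v v))
    (Prod.ext h.eq_of_nhds (congrArg (fun A : EuclideanSpace ℝ (Fin n) →L[ℝ]
      EuclideanSpace ℝ (Fin n) => A (extChartAt (𝓡 n).tangent v v).2) h.fderiv_eq))

/-- The induced coordinate changes of `TQ` are `(q, v) ↦ (ψ(q), Dψ(q) v)`. -/
lemma extChartAt_tangent_comp_symm {v₀ v : TangentBundle (𝓡 n) Q}
    {y : EuclideanSpace ℝ (Fin n) × EuclideanSpace ℝ (Fin n)}
    (hy : y ∈ (extChartAt (𝓡 n).tangent v).target)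
    (hy' : (extChartAt (𝓡 n) v.proj).symm y.1 ∈ (extChartAt (𝓡 n) v₀.proj).source) :
    extChartAt (𝓡 n).tangent v₀ ((extChartAt (𝓡 n).tangent v).symm y) =
      ((extChartAt (𝓡 n) v₀.proj ∘ (extChartAt (𝓡 n) v.proj).symm) y.1,
        fderiv ℝ (extChartAt (𝓡 n) v₀.proj ∘ (extChartAt (𝓡 n) v.proj).symm) y.1 y.2) := by
  set w := (extChartAt (𝓡 n).tangent v).symm y with hw
  -- `h1` says that `y = (e(q), De(q) u)` for `w = (q, u)` and the chart `e` of `Q` belonging to `v`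
  have hws : w.proj ∈ (extChartAt (𝓡 n) v.proj).source :=
    mem_extChartAt_tangent_source.1 ((extChartAt (𝓡 n).tangent v).map_target hy)
  have h1 := extChartAt_tangent_apply hws
  rw [hw, (extChartAt (𝓡 n).tangent v).right_inv hy, ← hw] at h1
  have h2 : y.1 = extChartAt (𝓡 n) v.proj w.proj := congrArg Prod.fst h1
  have h3 : (extChartAt (𝓡 n) v.proj).symm y.1 = w.proj := by
    rw [h2, (extChartAt (𝓡 n) v.proj).left_inv hws]
  have ht : y.1 ∈ (extChartAt (𝓡 n) v.proj).target := by
    rw [h2]; exact (extChartAt (𝓡 n) v.proj).map_source hws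
  rw [h3] at hy'
  rw [extChartAt_tangent_apply hy']
  refine Prod.ext (congrArg (extChartAt (𝓡 n) v₀.proj) h3).symm ?_
  have hd : MDifferentiableAt (𝓡 n) 𝓘(ℝ, EuclideanSpace ℝ (Fin n)) (extChartAt (𝓡 n) v₀.proj)
    ((extChartAt (𝓡 n) v.proj).symm y.1) :=
    mdifferentiableAt_extChartAt (by rwa [h3, ← extChartAt_source (𝓡 n)])
  have h4 := fun u => fderiv_comp_extChartAt_symm ht hd u
  rw [h3] at h4
  refine (h4 w.snd).symm.trans (congrArg _ (congrArg Prod.snd h1).symm)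

/-- The complete lift has the expression `aⁱ ∂/∂qⁱ + vʲ ∂aⁱ/∂qʲ ∂/∂vⁱ` in every chart of `TQ`
induced by a chart of `Q`. -/
lemma mfderiv_extChartAt_completeLift {X : VField (𝓡 n) Q} (hX : SmoothField (𝓡 n) X)
    {v₀ v : TangentBundle (𝓡 n) Q} (hv : v.proj ∈ (extChartAt (𝓡 n) v₀.proj).source) :
    mfderiv (𝓡 n).tangent 𝓘(ℝ, EuclideanSpace ℝ (Fin n) × EuclideanSpace ℝ (Fin n))
        (extChartAt (𝓡 n).tangent v₀) v (completeLift X v) =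
      (chartField (𝓡 n) X v₀.proj (extChartAt (𝓡 n).tangent v₀ v).1,
        fderiv ℝ (chartField (𝓡 n) X v₀.proj) (extChartAt (𝓡 n).tangent v₀ v).1
          (extChartAt (𝓡 n).tangent v₀ v).2) := by
  set F := EuclideanSpace ℝ (Fin n)
  set e := extChartAt (𝓡 n) v.proj
  set e₀ := extChartAt (𝓡 n) v₀.proj
  set c := extChartAt (𝓡 n).tangent v
  set c₀ := extChartAt (𝓡 n).tangent v₀
  have hcv : c v ∈ c.target := mem_extChartAt_target v
  have hev : e v.proj ∈ e.target := mem_extChartAt_target v.proj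
  have hcv1 : (c v).1 = e v.proj := rfl
  have hsymm : c.symm (c v) = v := extChartAt_to_inv v
  have hesymm : e.symm (e v.proj) = v.proj := extChartAt_to_inv v.proj
  -- near `e v.proj`, the inverse chart `e.symm` takes values in the source of `e₀`
  have hs : ∀ᶠ x in 𝓝 (e v.proj), e.symm x ∈ e₀.source := by
    have h1 : ContinuousAt e.symm (e v.proj) := continuousAt_extChartAt_symm v.proj
    exact h1.eventually (by rw [hesymm]; exact (isOpen_extChartAt_source v₀.proj).mem_nhds hv)
  have hψ : ContDiffAt ℝ 2 (e₀ ∘ e.symm) (e v.proj) := by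
    have h1 : ContMDiffAt 𝓘(ℝ, F) (𝓡 n) 2 e.symm (e v.proj) :=
      ((contMDiffOn_extChartAt_symm (n := ∞) v.proj).contMDiffAt
        (extChartAt_target_mem_nhds v.proj)).of_le ENat.LEInfty.out
    have h2 : ContMDiffAt (𝓡 n) 𝓘(ℝ, F) 2 e₀ (e.symm (e v.proj)) :=
      (contMDiffAt_extChartAt' (n := ∞) (by rwa [hesymm, ← extChartAt_source (𝓡 n)])).of_le
        ENat.LEInfty.out
    exact (h2.comp _ h1).contDiffAt
  have hb : ContDiffAt ℝ ∞ (chartField (𝓡 n) X v₀.proj) (e₀ (e.symm (e v.proj))) :=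
    contDiffAt_chartField hX (e₀.map_source (by rwa [hesymm]))
  -- the components of `X` in the two charts are related by the derivative of the transition map
  have hab : ∀ᶠ y in 𝓝 (e v.proj), chartField (𝓡 n) X v₀.proj ((e₀ ∘ e.symm) y) =
      fderiv ℝ (e₀ ∘ e.symm) y (chartField (𝓡 n) X v.proj y) := by
    filter_upwards [hs, extChartAt_target_mem_nhds v.proj] with y hy hyt
    have hd : MDifferentiableAt (𝓡 n) 𝓘(ℝ, F) e₀ (e.symm y) :=
      mdifferentiableAt_extChartAt (by rwa [← extChartAt_source (𝓡 n)])
    have h4 := fderiv_comp_extChartAt_symm hyt hd (X (e.symm y))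
    rw [chartField_eq hyt]
    refine (chartField_eq (e₀.map_source hy)).trans (Eq.trans ?_ h4.symm)
    exact congrArg (fun q => (mfderiv (𝓡 n) 𝓘(ℝ, F) e₀ q (X q) : F)) (e₀.left_inv hy)
  have key := fderiv_tangent_coordChange_apply hψ
    ((contDiffAt_chartField hX hev).differentiableAt (by simp)) (hb.differentiableAt (by simp))
    hab (c v).2
  have hcc : c₀ ∘ c.symm =ᶠ[𝓝 (c v)]
      fun y : F × F => ((e₀ ∘ e.symm) y.1, fderiv ℝ (e₀ ∘ e.symm) y.1 y.2) := by
    filter_upwards [extChartAt_target_mem_nhds v,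
      continuous_fst.continuousAt.eventually (hcv1 ▸ hs)] with y hy hy'
    exact extChartAt_tangent_comp_symm hy hy'
  have hd : MDifferentiableAt (𝓡 n).tangent 𝓘(ℝ, F × F) c₀ (c.symm (c v)) :=
    mdifferentiableAt_extChartAt (by
      rw [hsymm, TangentBundle.mem_chart_source_iff, ← extChartAt_source (𝓡 n)]; exact hv)
  have h5 := mfderiv_comp_apply (c v) (I := 𝓘(ℝ, F × F)) hd
    (mdifferentiableAt_extChartAt_symm hcv)
    ((chartField (𝓡 n) X v.proj (e v.proj),
      fderiv ℝ (chartField (𝓡 n) X v.proj) (e v.proj) (c v).2) : F × F)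
  have h6 : mfderiv (𝓡 n).tangent 𝓘(ℝ, F × F) c₀ v (completeLift X v) =
      fderiv ℝ (c₀ ∘ c.symm) (c v) (chartField (𝓡 n) X v.proj (e v.proj),
        fderiv ℝ (chartField (𝓡 n) X v.proj) (e v.proj) (c v).2) := by
    rw [completeLift_eq]
    refine Eq.trans ?_ (h5.symm.trans
      (congrArg (fun A : F × F →L[ℝ] F × F => A _) mfderiv_eq_fderiv))
    rw [hsymm]
  have h7 := hcc.eq_of_nhds
  rw [Function.comp_apply, hsymm] at h7
  rw [h6, hcc.fderiv_eq, h7]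
  exact key

end PhaseCharts

/-! ### Induced charts of the phase space -/

section PhaseChartExpressions

open Filter Topology

variable {n : ℕ} {Q : Type*} [TopologicalSpace Q] [ChartedSpace (EuclideanSpace ℝ (Fin n)) Q]
  [IsManifold (𝓡 n) ∞ Q]

/-- The space of coordinates `(t, (q, v), z)` on `ℝ × TQ × ℝ`. -/
abbrev PhaseCoord (n : ℕ) : Type :=
  ℝ × (EuclideanSpace ℝ (Fin n) × EuclideanSpace ℝ (Fin n)) × ℝ

/-- Composing a chart of phase space with a linear map on the model space. -/
lemma clm_mfderiv_extChartAt {G : Type*} [NormedAddCommGroup G] [NormedSpace ℝ G]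
    (A : PhaseCoord n →L[ℝ] G)
    {p₀ p : Phase n Q} (hp : p ∈ (extChartAt (phaseModel n) p₀).source)
    (w : TangentSpace (phaseModel n) p) :
    mfderiv (phaseModel n) 𝓘(ℝ, G) (fun p => A (extChartAt (phaseModel n) p₀ p)) p w =
      A (mfderiv (phaseModel n) 𝓘(ℝ, PhaseCoord n) (extChartAt (phaseModel n) p₀) p w) := by
  have hd : MDifferentiableAt (phaseModel n) 𝓘(ℝ, PhaseCoord n)
      (extChartAt (phaseModel n) p₀) p :=
    mdifferentiableAt_extChartAt (by rwa [← extChartAt_source (phaseModel n)])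
  refine (mfderiv_comp_apply p (I' := 𝓘(ℝ, PhaseCoord n))
    A.differentiableAt.mdifferentiableAt hd w).trans ?_
  exact congrArg (fun B : _ →L[ℝ] G => B _) (mfderiv_eq_fderiv.trans A.fderiv)

lemma actionPart_mfderiv_extChartAt {p₀ p : Phase n Q}
    (hp : p ∈ (extChartAt (phaseModel n) p₀).source) (w : TangentSpace (phaseModel n) p) :
    actionPart _ (mfderiv (phaseModel n) 𝓘(ℝ, PhaseCoord n) (extChartAt (phaseModel n) p₀) p w) =
      differential (phaseModel n) actionCoord p w :=
  (clm_mfderiv_extChartAt (actionPart _) hp w).symm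

lemma basePart_mfderiv_extChartAt {p₀ p : Phase n Q}
    (hp : p ∈ (extChartAt (phaseModel n) p₀).source) (w : TangentSpace (phaseModel n) p) :
    basePart _ (mfderiv (phaseModel n) 𝓘(ℝ, PhaseCoord n) (extChartAt (phaseModel n) p₀) p w) =
      mfderiv (𝓡 n) 𝓘(ℝ, EuclideanSpace ℝ (Fin n)) (extChartAt (𝓡 n) (baseProj p₀)) (baseProj p)
        (mfderiv (phaseModel n) (𝓡 n) (baseProj : Phase n Q → Q) p w) := by
  have hq := mem_extChartAt_phase_source.1 hp
  have hd : MDifferentiableAt (𝓡 n) 𝓘(ℝ, EuclideanSpace ℝ (Fin n))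
      (extChartAt (𝓡 n) (baseProj p₀)) (baseProj p) :=
    mdifferentiableAt_extChartAt (by rwa [← extChartAt_source (𝓡 n)])
  refine (clm_mfderiv_extChartAt (basePart _) hp w).symm.trans ?_
  exact mfderiv_comp_apply p hd ((contMDiff_baseProj (Q := Q) p).mdifferentiableAt (by simp)) w

/-- The coordinate expression of the vertical lift. -/
lemma mfderiv_extChartAt_verticalLift {p₀ p : Phase n Q}
    (hp : p ∈ (extChartAt (phaseModel n) p₀).source) (u : TangentSpace (𝓡 n) (baseProj p)) :
    mfderiv (phaseModel n) 𝓘(ℝ, PhaseCoord n) (extChartAt (phaseModel n) p₀) p (verticalLift p u) =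
      verticalVector _ (mfderiv (𝓡 n) 𝓘(ℝ, EuclideanSpace ℝ (Fin n))
        (extChartAt (𝓡 n) (baseProj p₀)) (baseProj p) u) := by
  have hq := mem_extChartAt_phase_source.1 hp
  have hd : MDifferentiableAt (phaseModel n) 𝓘(ℝ, PhaseCoord n)
      (extChartAt (phaseModel n) p₀) p :=
    mdifferentiableAt_extChartAt (by rwa [← extChartAt_source (phaseModel n)])
  refine (mfderiv_verticalLift hd u).trans ?_
  let A : EuclideanSpace ℝ (Fin n) →L[ℝ] EuclideanSpace ℝ (Fin n) :=
    mfderiv (𝓡 n) 𝓘(ℝ, EuclideanSpace ℝ (Fin n)) (extChartAt (𝓡 n) (baseProj p₀)) (baseProj p)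
  have h1 : (fun u => extChartAt (phaseModel n) p₀ (fibreIncl p u)) = fun u =>
      ((p.1, (extChartAt (𝓡 n) (baseProj p₀) (baseProj p), 0), p.2.2) : PhaseCoord n) +
      ((verticalVector _).comp A) u := by
    funext u
    rw [extChartAt_phase_apply, extChartAt_tangent_apply (by exact hq)]
    simp only [ContinuousLinearMap.comp_apply, verticalVector_apply, Prod.mk_add_mk, add_zero,
      zero_add]
    rfl
  have h2 := ((verticalVector _).comp A).hasFDerivAt (x := p.2.1.snd) |>.const_add
    ((p.1, (extChartAt (𝓡 n) (baseProj p₀) (baseProj p), 0), p.2.2) : PhaseCoord n)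
  rw [h1]
  exact congrArg (fun B : EuclideanSpace ℝ (Fin n) →L[ℝ] _ => B u)
    (mfderiv_eq_fderiv.trans h2.fderiv)

/-- The contact Lagrangian form is `dz - ∂L/∂vⁱ dqⁱ` in induced coordinates. -/
lemma contactForm_extChartAt_symm {L : Phase n Q → ℝ}
    (hL : ContMDiff (phaseModel n) 𝓘(ℝ, ℝ) ∞ L) {p₀ : Phase n Q} {x : PhaseCoord n}
    (hx : x ∈ (extChartAt (phaseModel n) p₀).target)
    (w : TangentSpace (phaseModel n) ((extChartAt (phaseModel n) p₀).symm x)) :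
    contactForm L ((extChartAt (phaseModel n) p₀).symm x) w =
      coordContactForm (L ∘ (extChartAt (phaseModel n) p₀).symm) x
        (mfderiv (phaseModel n) 𝓘(ℝ, PhaseCoord n)
          (extChartAt (phaseModel n) p₀) ((extChartAt (phaseModel n) p₀).symm x) w) := by
  have hp := (extChartAt (phaseModel n) p₀).map_target hx
  refine congrArg₂ (· - ·) (actionPart_mfderiv_extChartAt hp w).symm ?_
  refine (fderiv_comp_extChartAt_symm hx ((hL _).mdifferentiableAt (by simp)) _).symm.trans ?_
  refine congrArg (fderiv ℝ (L ∘ (extChartAt (phaseModel n) p₀).symm) x) ?_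
  refine (mfderiv_extChartAt_verticalLift hp _).trans ?_
  exact congrArg (verticalVector _) (basePart_mfderiv_extChartAt hp w).symm

/-- At the base point of the preferred chart, the chart has identity derivative, so a tangent vector
is its own coordinate expression. -/
lemma contactForm_eq {L : Phase n Q → ℝ} (hL : ContMDiff (phaseModel n) 𝓘(ℝ, ℝ) ∞ L)
    (p : Phase n Q) (w : TangentSpace (phaseModel n) p) :
    contactForm L p w = coordContactForm (L ∘ (extChartAt (phaseModel n) p).symm)
      (extChartAt (phaseModel n) p p) w := by
  have h := fun w => contactForm_extChartAt_symm hL (mem_extChartAt_target (I := phaseModel n) p) w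
  rw [extChartAt_to_inv] at h
  refine (h w).trans (congrArg (coordContactForm _ _) ?_)
  exact congrArg (fun A : PhaseCoord n →L[ℝ] PhaseCoord n => A w) mfderiv_extChartAt_self

/-- The Lagrangian energy is `vⁱ ∂L/∂vⁱ - L` in induced coordinates. -/
lemma energy_extChartAt_symm {L : Phase n Q → ℝ}
    (hL : ContMDiff (phaseModel n) 𝓘(ℝ, ℝ) ∞ L) {p₀ : Phase n Q} {x : PhaseCoord n}
    (hx : x ∈ (extChartAt (phaseModel n) p₀).target) :
    energy L ((extChartAt (phaseModel n) p₀).symm x) =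
      coordEnergy (L ∘ (extChartAt (phaseModel n) p₀).symm) x := by
  have hp := (extChartAt (phaseModel n) p₀).map_target hx
  refine congrArg₂ (· - ·) ?_ rfl
  refine (fderiv_comp_extChartAt_symm hx ((hL _).mdifferentiableAt (by simp)) _).symm.trans ?_
  refine congrArg (fderiv ℝ (L ∘ (extChartAt (phaseModel n) p₀).symm) x) ?_
  refine (mfderiv_extChartAt_verticalLift hp _).trans (congrArg (verticalVector _) ?_)
  have h1 := congrArg Prod.snd (extChartAt_tangent_apply (v₀ := p₀.2.1)
    (mem_extChartAt_phase_source.1 hp))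
  refine h1.symm.trans ?_
  exact congrArg (velocityPart _) ((extChartAt (phaseModel n) p₀).right_inv hx)

/-- The action-dependent complete lift in induced coordinates. -/
lemma chartField_actionDependentCompleteLift {X : VField (𝓡 n) Q} (hX : SmoothField (𝓡 n) X)
    (ζ : ℝ → ℝ) {p₀ : Phase n Q} {x : PhaseCoord n}
    (hx : x ∈ (extChartAt (phaseModel n) p₀).target) :
    chartField (phaseModel n) (actionDependentCompleteLift X ζ) p₀ x =
      coordLift (chartField (𝓡 n) X (baseProj p₀)) ζ x := by
  have hp := (extChartAt (phaseModel n) p₀).map_target hx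
  refine (chartField_eq hx).trans ?_
  have hr := (extChartAt (phaseModel n) p₀).right_inv hx
  set p := (extChartAt (phaseModel n) p₀).symm x
  have hq := mem_extChartAt_phase_source.1 hp
  rw [← hr]
  set Z : TangentSpace (phaseModel n) p := actionDependentCompleteLift X ζ p with hZ
  refine Prod.ext ?_ (Prod.ext ?_ ?_)
  · refine (clm_mfderiv_extChartAt (ContinuousLinearMap.fst ℝ _ _) hp Z).symm.trans ?_
    exact congrArg (fun A : PhaseCoord n →L[ℝ] ℝ => A Z)
      (mfderiv_fst (I := 𝓘(ℝ, ℝ)) (I' := fibreModel n) (x := p))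
  · refine (clm_mfderiv_extChartAt ((ContinuousLinearMap.fst ℝ _ _).comp
      (ContinuousLinearMap.snd ℝ _ _)) hp Z).symm.trans ?_
    refine Eq.trans ?_ (mfderiv_extChartAt_completeLift hX (v₀ := p₀.2.1) (v := p.2.1) hq)
    have hd : MDifferentiableAt (𝓡 n).tangent
        𝓘(ℝ, EuclideanSpace ℝ (Fin n) × EuclideanSpace ℝ (Fin n))
        (extChartAt (𝓡 n).tangent p₀.2.1) p.2.1 :=
      mdifferentiableAt_extChartAt (by
        rw [TangentBundle.mem_chart_source_iff, ← extChartAt_source (𝓡 n)]; exact hq)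
    have h1 : HasMFDerivAt (phaseModel n) (𝓡 n).tangent (fun p : Phase n Q => p.2.1) p _ :=
      (hasMFDerivAt_fst (I := (𝓡 n).tangent) (I' := 𝓘(ℝ, ℝ)) p.2).comp p
        (hasMFDerivAt_snd (I := 𝓘(ℝ, ℝ)) (I' := fibreModel n) p)
    exact congrArg (fun A : PhaseCoord n →L[ℝ]
      EuclideanSpace ℝ (Fin n) × EuclideanSpace ℝ (Fin n) => A Z)
      (hd.hasMFDerivAt.comp p h1).mfderiv
  · refine (clm_mfderiv_extChartAt (actionPart _) hp Z).symm.trans ?_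
    have h1 : HasMFDerivAt (phaseModel n) 𝓘(ℝ, ℝ) (fun p : Phase n Q => p.2.2) p _ :=
      (hasMFDerivAt_snd (I := (𝓡 n).tangent) (I' := 𝓘(ℝ, ℝ)) p.2).comp p
        (hasMFDerivAt_snd (I := 𝓘(ℝ, ℝ)) (I' := fibreModel n) p)
    exact congrArg (fun A : PhaseCoord n →L[ℝ] ℝ =>
      A Z) h1.mfderiv

/-- The projection to `Q` of a smooth split vector field is smooth. -/
lemma IsSplit.smoothField {Y : VField ((𝓡 n).prod 𝓘(ℝ, ℝ)) (Q × ℝ)} {X : VField (𝓡 n) Q}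
    {ζ : ℝ → ℝ} (hYX : IsSplit Y X ζ) (hY : SmoothField ((𝓡 n).prod 𝓘(ℝ, ℝ)) Y) :
    SmoothField (𝓡 n) X := by
  have h1 : ContMDiff ((𝓡 n).prod 𝓘(ℝ, ℝ)).tangent (𝓡 n).tangent ∞
      (tangentMap ((𝓡 n).prod 𝓘(ℝ, ℝ)) (𝓡 n) (Prod.fst : Q × ℝ → Q)) :=
    contMDiff_fst.contMDiff_tangentMap (n := ∞) (by simp)
  have h2 : ContMDiff (𝓡 n) ((𝓡 n).prod 𝓘(ℝ, ℝ)) ∞ (fun q : Q => (q, (0 : ℝ))) :=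
    contMDiff_id.prodMk contMDiff_const
  refine (h1.comp (hY.comp h2)).congr fun q => ?_
  exact congrArg (TotalSpace.mk q) (hYX (q, 0)).1.symm

/-- The projection to `ℝ` of a smooth split vector field is smooth, if `Q` is nonempty. -/
lemma IsSplit.contDiff {Y : VField ((𝓡 n).prod 𝓘(ℝ, ℝ)) (Q × ℝ)} {X : VField (𝓡 n) Q}
    {ζ : ℝ → ℝ} (hYX : IsSplit Y X ζ) (hY : SmoothField ((𝓡 n).prod 𝓘(ℝ, ℝ)) Y) (q : Q) :
    ContDiff ℝ ∞ ζ := by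
  have h1 : ContMDiff ((𝓡 n).prod 𝓘(ℝ, ℝ)).tangent 𝓘(ℝ, ℝ).tangent ∞
      (tangentMap ((𝓡 n).prod 𝓘(ℝ, ℝ)) 𝓘(ℝ, ℝ) (Prod.snd : Q × ℝ → ℝ)) :=
    contMDiff_snd.contMDiff_tangentMap (n := ∞) (by simp)
  have h2 : ContMDiff 𝓘(ℝ, ℝ) ((𝓡 n).prod 𝓘(ℝ, ℝ)) ∞ (fun z : ℝ => (q, z)) :=
    contMDiff_const.prodMk contMDiff_id
  have h3 := (contMDiff_snd_tangentBundle_modelSpace ℝ 𝓘(ℝ, ℝ)).comp (h1.comp (hY.comp h2))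
  exact (h3.congr fun z => (hYX (q, z)).2.symm).contDiff

lemma basePart_mem_target {p₀ : Phase n Q} {x : PhaseCoord n}
    (hx : x ∈ (extChartAt (phaseModel n) p₀).target) :
    basePart _ x ∈ (extChartAt (𝓡 n) (baseProj p₀)).target := by
  have h := (extChartAt (𝓡 n) (baseProj p₀)).map_source
    (mem_extChartAt_phase_source.1 ((extChartAt (phaseModel n) p₀).map_target hx))
  have h2 := congrArg (basePart _) ((extChartAt (phaseModel n) p₀).right_inv hx)
  rw [← h2]
  exact h

lemma contDiffAt_coordLift {F : Type*} [NormedAddCommGroup F] [NormedSpace ℝ F] {a : F → F}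
    {ζ : ℝ → ℝ} {x : ℝ × (F × F) × ℝ} (ha : ContDiffAt ℝ ∞ a (basePart F x))
    (hζ : ContDiff ℝ ∞ ζ) : ContDiffAt ℝ ∞ (coordLift a ζ) x := by
  have h1 : ContDiffAt ℝ ∞ (fun x => a (basePart F x)) x :=
    ha.comp x (basePart F).contDiff.contDiffAt
  have h2 : ContDiffAt ℝ ∞ (fun x => fderiv ℝ a (basePart F x)) x :=
    (ha.fderiv_right (m := ∞) (by simp)).comp x (basePart F).contDiff.contDiffAt
  exact contDiffAt_const.prodMk
    ((h1.prodMk (h2.clm_apply (velocityPart F).contDiff.contDiffAt)).prodMk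
      (hζ.contDiffAt.comp x (actionPart F).contDiff.contDiffAt))

/-- The infinitesimal version of `isConformalHamiltonianSymmetry_actionDependentLift`. -/
theorem isInfinitesimalConformalHamiltonianSymmetry_actionDependentCompleteLift
    {L : Phase n Q → ℝ} (hL : ContMDiff (phaseModel n) 𝓘(ℝ, ℝ) ∞ L)
    {Y : VField ((𝓡 n).prod 𝓘(ℝ, ℝ)) (Q × ℝ)} {X : VField (𝓡 n) Q} {ζ : ℝ → ℝ}
    (hY : SmoothField ((𝓡 n).prod 𝓘(ℝ, ℝ)) Y) (hYX : IsSplit Y X ζ)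
    (hinv : ∀ p : Phase n Q, lieDerivFun (phaseModel n) (actionDependentCompleteLift X ζ) L p =
      deriv ζ (actionCoord p) * L p) :
    IsInfinitesimalConformalHamiltonianSymmetry (phaseModel n)
      (differential (phaseModel n) timeCoord) (contactForm L) (energy L)
      (fun p => deriv ζ (actionCoord p)) (actionDependentCompleteLift X ζ) := by
  have hX := hYX.smoothField hY
  -- if `Q` is empty nothing is known about `ζ`, but then there is no point `p` either
  have hζ (p : Phase n Q) : ContDiff ℝ ∞ ζ := hYX.contDiff hY (baseProj p)
  have ha (p : Phase n Q) : ContDiffAt ℝ ∞ (chartField (𝓡 n) X (baseProj p))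
      (basePart _ (extChartAt (phaseModel n) p p)) :=
    contDiffAt_chartField hX (basePart_mem_target (mem_extChartAt_target p))
  have hΛ (p : Phase n Q) : ContDiffAt ℝ ∞ (L ∘ (extChartAt (phaseModel n) p).symm)
      (extChartAt (phaseModel n) p p) :=
    ((hL _).comp _ ((contMDiffOn_extChartAt_symm p).contMDiffAt
      (extChartAt_target_mem_nhds p))).contDiffAt
  have hinv' (p : Phase n Q) : ∀ᶠ y in 𝓝 (extChartAt (phaseModel n) p p),
      fderiv ℝ (L ∘ (extChartAt (phaseModel n) p).symm) y
        (coordLift (chartField (𝓡 n) X (baseProj p)) ζ y) =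
      deriv ζ (actionPart _ y) * (L ∘ (extChartAt (phaseModel n) p).symm) y := by
    filter_upwards [extChartAt_target_mem_nhds p] with y hy
    rw [← chartField_actionDependentCompleteLift hX ζ hy]
    refine (lieDerivFun_extChartAt_symm hy ((hL _).mdifferentiableAt (by simp))).trans ?_
    -- the chart is the identity in the `z` direction
    have hz : actionCoord ((extChartAt (phaseModel n) p).symm y) = actionPart _ y := rfl
    rw [hinv, hz]
    rfl
  have hZ (p : Phase n Q) : chartField (phaseModel n) (actionDependentCompleteLift X ζ) p
      =ᶠ[𝓝 (extChartAt (phaseModel n) p p)] coordLift (chartField (𝓡 n) X (baseProj p)) ζ := by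
    filter_upwards [extChartAt_target_mem_nhds p] with y hy
    exact chartField_actionDependentCompleteLift hX ζ hy
  refine ⟨fun p => ?_, fun p => ?_, fun p => ?_, fun p W hW => ?_, fun p => ?_⟩
  · exact smoothFieldAt_of_chartField (contDiffAt_coordLift (ha p) (hζ p)) fun x hx =>
      chartField_actionDependentCompleteLift hX ζ hx
  · exact ((contDiff_infty_iff_deriv.1 (hζ p)).2.contMDiff.comp contMDiff_actionCoord) p
  · exact congrArg (fun A : PhaseCoord n →L[ℝ] ℝ =>
      A (actionDependentCompleteLift X ζ p))
      (mfderiv_fst (I := 𝓘(ℝ, ℝ)) (I' := fibreModel n) (x := p))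
  · have hW' := hW.differentiableAt_chartField
    have key := lieDeriv_coordContactForm ((hΛ p).of_le ENat.LEInfty.out)
      ((ha p).of_le ENat.LEInfty.out) ((hζ p).of_le ENat.LEInfty.out) (hinv' p) hW'
    -- `η(W)` and the bracket are both computed in the preferred chart at `p`
    have hη : (fun q => contactForm L q (W q)) ∘ (extChartAt (phaseModel n) p).symm
        =ᶠ[𝓝 (extChartAt (phaseModel n) p p)]
        fun x => coordContactForm (L ∘ (extChartAt (phaseModel n) p).symm) x
          (chartField (phaseModel n) W p x) := by
      filter_upwards [extChartAt_target_mem_nhds p] with x hx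
      rw [chartField_eq hx]
      exact contactForm_extChartAt_symm hL hx _
    have hd := (hasFDerivAt_coordContactForm ((hΛ p).of_le ENat.LEInfty.out) hW').differentiableAt
    have e1 : lieDerivFun (phaseModel n) (actionDependentCompleteLift X ζ)
        (fun q => contactForm L q (W q)) p = _ :=
      lieDerivFun_eq_fderiv (mdifferentiableAt_of_comp_extChartAt_symm
        (hd.congr_of_eventuallyEq hη))
    rw [hη.fderiv_eq, (hZ p).eq_of_nhds] at e1
    have e2 : contactForm L p (VectorField.mlieBracket (phaseModel n)
        (actionDependentCompleteLift X ζ) W p) = _ :=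
      (congrArg (contactForm L p) mlieBracket_eq_lieBracket).trans (contactForm_eq hL p _)
    rw [(hZ p).lieBracket_vectorField_eq .rfl] at e2
    have e3 := hη.eq_of_nhds
    rw [Function.comp_apply, extChartAt_to_inv] at e3
    refine (congrArg₂ (· - ·) e1 e2).trans (key.trans ?_)
    exact congrArg (deriv ζ p.2.2 * ·) e3.symm
  · have key := lieDeriv_coordEnergy ((hΛ p).of_le ENat.LEInfty.out)
      ((ha p).of_le ENat.LEInfty.out) ((hζ p).of_le ENat.LEInfty.out) (hinv' p)
    have hE : energy L ∘ (extChartAt (phaseModel n) p).symm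
        =ᶠ[𝓝 (extChartAt (phaseModel n) p p)]
        coordEnergy (L ∘ (extChartAt (phaseModel n) p).symm) := by
      filter_upwards [extChartAt_target_mem_nhds p] with x hx
      exact energy_extChartAt_symm hL hx
    have hd := (hasFDerivAt_coordEnergy ((hΛ p).of_le ENat.LEInfty.out)).differentiableAt
    have e1 : lieDerivFun (phaseModel n) (actionDependentCompleteLift X ζ) (energy L) p = _ :=
      lieDerivFun_eq_fderiv (mdifferentiableAt_of_comp_extChartAt_symm
        (hd.congr_of_eventuallyEq hE))
    rw [hE.fderiv_eq, (hZ p).eq_of_nhds] at e1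
    have e3 := hE.eq_of_nhds
    rw [Function.comp_apply, extChartAt_to_inv] at e3
    exact e1.trans (key.trans (congrArg (deriv ζ p.2.2 * ·) e3.symm))

end PhaseChartExpressions

end CocontactLagrangian

theorem mainTheorem9 {n : ℕ} {Q : Type*} [TopologicalSpace Q] [T2Space Q]
    [SecondCountableTopology Q] [ChartedSpace (EuclideanSpace ℝ (Fin n)) Q]
    [IsManifold (𝓡 n) ∞ Q]
    (L : Phase n Q → ℝ) (hL : ContMDiff (phaseModel n) 𝓘(ℝ, ℝ) ∞ L) (hreg : IsRegularLagrangian L) :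
    (∀ (φz : Diffeomorph 𝓘(ℝ, ℝ) 𝓘(ℝ, ℝ) ℝ ℝ ∞) (Φ : Phase n Q → Phase n Q),
      IsExtendedNaturalSymmetry L φz Φ →
        IsConformalHamiltonianSymmetry (fibreModel n) (contactForm L) (energy L)
          (fun p => deriv φz (actionCoord p)) Φ) ∧
    (∀ (ζ : ℝ → ℝ) (Z : VField (phaseModel n) (Phase n Q)),
      IsInfinitesimalExtendedNaturalSymmetry L ζ Z →
        IsInfinitesimalConformalHamiltonianSymmetry (phaseModel n)
          (differential (phaseModel n) timeCoord) (contactForm L) (energy L)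
          (fun p => deriv ζ (actionCoord p)) Z) := by
  refine ⟨?_, ?_⟩
  · rintro φz _ ⟨⟨φQ, rfl⟩, h⟩
    exact isConformalHamiltonianSymmetry_actionDependentLift hL φQ φz h
  · rintro ζ _ ⟨⟨Y, X, hY, hYX, rfl⟩, h⟩
    exact isInfinitesimalConformalHamiltonianSymmetry_actionDependentCompleteLift hL hY hYX h
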